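/- Rings are associative with identity, not necessarily commutative, and modules are unital right modules. Let $M$ be a right $R$-module. A submodule $N$ of a module $D$ is \emph{essential} in $D$ if $N\cap K\neq 0$ for every nonzero submodule $K\leq D$. For $X\subseteq M$ put $r_R(X)=\{r\in R \mid xr=0 \text{ for all } x\in X\}$. The \emph{singular submodule} of $M$ is $Z(M)=\{m\in M \mid r_R(\{m\}) \text{ is essential in } R_R\}$; $M$ is \emph{nonsingular} if $Z(M)=0$, and $R$ is \emph{right nonsingular} if $R_R$ is nonsingular. A submodule $N\leq M$ is \emph{fully invariant} if $f(N)\subseteq N$ for every $f\in \mathrm{End}_R(M)$, and $M$ is \emph{FI-extending} if every fully invariant submodule of $M$ is essential in a direct summand of $M$. The ring $R$ is \emph{semiprime} if $aRa=0$ implies $a=0$; \emph{prime} if $R\neq 0$ and $aRb=0$ implies $a=0$ or $b=0$; \emph{quasi-Baer} (respectively \emph{Baer}) if for every two-sided ideal (respectively every subset) $X$ of $R$ there is an idempotent $e\in R$ with $r_R(X)=eR$. An \emph{$AW^*$-algebra} is a unital complex $C^*$-algebra which is a Baer ring. \textbf{Proposition.} If $R$ is a right nonsingular semiprime quasi-Baer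 ring, then every projective right $R$-module is nonsingular and FI-extending. Moreover, each of the following rings is right nonsingular, semiprime and quasi-Baer: right nonsingular prime rings, commutative Baer rings, and $AW^*$-algebras. -/

import Mathlib

open MulOpposite

/-! A right module over `R` is a module over `Rᵐᵒᵖ`; the action `m * r` is `op r • m`, and the
right ideals of `R` are the `Rᵐᵒᵖ`-submodules of `R`. -/

namespace RightModule

section Lattice

variable {S M : Type*} [Ring S] [AddCommGroup M] [Module S M]

/-- `N` is an essential submodule of the submodule `D`: it is contained in `D` and meets every
nonzero submodule of `D` nontrivially. -/
def IsEssentialIn (N D : Submodule S M) : Prop :=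
  N ≤ D ∧ ∀ K : Submodule S M, K ≤ D → K ≠ ⊥ → N ⊓ K ≠ ⊥

/-- `D` is a direct summand of the ambient module. -/
def IsDirectSummand (D : Submodule S M) : Prop :=
  ∃ D' : Submodule S M, IsCompl D D'

variable (S M) in
/-- Every fully invariant submodule is essential in a direct summand. -/
def IsFIExtending : Prop :=
  ∀ N : Submodule S M, N.IsFullyInvariant →
    ∃ D : Submodule S M, IsDirectSummand D ∧ IsEssentialIn N D

end Lattice

section Annihilator

variable (R : Type*) {M : Type*} [Ring R] [AddCommGroup M] [Module Rᵐᵒᵖ M]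

/-- The right annihilator `{r ∈ R | n r = 0 for all n ∈ X}` of a subset `X` of a right `R`-module,
as a right ideal of `R`. -/
def rightAnnihilator (X : Set M) : Submodule Rᵐᵒᵖ R where
  carrier := {r | ∀ n ∈ X, op r • n = 0}
  zero_mem' := by
    intro n _
    simp
  add_mem' := by
    intro a b ha hb n hn
    rw [op_add, add_smul, ha n hn, hb n hn, add_zero]
  smul_mem' := by
    intro c x hx n hn
    have h : op (c • x) = c * op x := by
      rw [← op_unop c, op_smul_eq_mul, op_mul]
    rw [h, mul_smul, hx n hn, smul_zero]

variable {R} in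
theorem mem_rightAnnihilator {X : Set M} {r : R} :
    r ∈ rightAnnihilator R X ↔ ∀ n ∈ X, op r • n = 0 := Iff.rfl

variable (M) in
/-- The singular submodule `Z(M)` of a right `R`-module `M`: the elements whose right annihilator
is an essential right ideal of `R`. -/
def singularSubmodule : Submodule Rᵐᵒᵖ M where
  carrier := {m | IsEssentialIn (rightAnnihilator R {m}) ⊤}
  zero_mem' := by
    refine ⟨le_top, fun K _ hK => ?_⟩
    have h : rightAnnihilator R {(0 : M)} = ⊤ := by
      rw [eq_top_iff]
      intro r _
      simp [mem_rightAnnihilator]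
    rwa [h, top_inf_eq]
  add_mem' := by
    intro a b ha hb
    refine ⟨le_top, fun K _ hK => ?_⟩
    have h := ha.2 _ le_top (hb.2 K le_top hK)
    refine ne_bot_of_le_ne_bot h ?_
    rintro x ⟨hxa, hxb, hxK⟩
    refine ⟨?_, hxK⟩
    intro n hn
    rw [Set.mem_singleton_iff] at hn
    rw [hn, smul_add, hxa a rfl, hxb b rfl, add_zero]
  smul_mem' := by
    intro c m hm
    refine ⟨le_top, fun K _ hK => ?_⟩
    by_cases h0 : ∀ k ∈ K, unop c * k = 0
    · refine ne_bot_of_le_ne_bot hK ?_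
      intro k hk
      refine ⟨?_, hk⟩
      intro n hn
      rw [Set.mem_singleton_iff] at hn
      have h : op k * c = 0 := by
        rw [← op_unop c, ← op_mul, h0 k hk, op_zero]
      rw [hn, ← mul_smul, h, zero_smul]
    · push Not at h0
      obtain ⟨k, hk, hk0⟩ := h0
      let f : R →ₗ[Rᵐᵒᵖ] R :=
        { toFun := fun x => unop c * x
          map_add' := fun x y => mul_add _ x y
          map_smul' := fun s x => (mul_assoc (unop c) x (unop s)).symm }
      have hne : Submodule.map f K ≠ ⊥ := by
        intro h
        have h1 : f k ∈ Submodule.map f K := Submodule.mem_map_of_mem hk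
        rw [h] at h1
        exact hk0 ((Submodule.mem_bot _).1 h1)
      obtain ⟨y, ⟨hy, x, hx, hxy⟩, hy0⟩ :=
        Submodule.exists_mem_ne_zero_of_ne_bot (hm.2 _ le_top hne)
      have hxy' : unop c * x = y := hxy
      refine (Submodule.ne_bot_iff _).2 ⟨x, ⟨?_, hx⟩, ?_⟩
      · intro n hn
        rw [Set.mem_singleton_iff] at hn
        have h : op x * c = op y := by
          rw [← hxy', op_mul, op_unop]
        rw [hn, ← mul_smul, h]
        exact hy m rfl
      · rintro rfl
        exact hy0 (by rw [← hxy', mul_zero])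

variable (M) in
/-- A right module is nonsingular if its singular submodule is zero. -/
def IsNonsingular : Prop := singularSubmodule R M = ⊥

/-- `R` is right nonsingular: the right module `R` is nonsingular. -/
def IsRightNonsingularRing : Prop := IsNonsingular R R

/-- `R` is semiprime: `a R a = 0` implies `a = 0`. -/
def IsSemiprimeRing : Prop :=
  ∀ a : R, (∀ r : R, a * r * a = 0) → a = 0

/-- `R` is prime: it is nonzero, and `a R b = 0` implies `a = 0` or `b = 0`. -/
def IsPrimeRing : Prop :=
  Nontrivial R ∧ ∀ a b : R, (∀ r : R, a * r * b = 0) → a = 0 ∨ b = 0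

/-- `R` is quasi-Baer: the right annihilator of every two-sided ideal is the right ideal
generated by an idempotent. -/
def IsQuasiBaerRing : Prop :=
  ∀ I : TwoSidedIdeal R, ∃ e : R, IsIdempotentElem e ∧
    rightAnnihilator R (I : Set R) = Submodule.span Rᵐᵒᵖ {e}

/-- `R` is Baer: the right annihilator of every subset is the right ideal generated by an
idempotent. -/
def IsBaerRing : Prop :=
  ∀ X : Set R, ∃ e : R, IsIdempotentElem e ∧
    rightAnnihilator R X = Submodule.span Rᵐᵒᵖ {e}

end Annihilator

/-- A (unital) C⋆-algebra is an AW⋆-algebra if it is a Baer ring. -/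
def IsAWStarAlgebra (A : Type*) [CStarAlgebra A] : Prop := IsBaerRing A

end RightModule

namespace RightModule

section Ring

variable {R : Type*} [Ring R]

/-! For fully invariant `N` in a projective `M`, put I = {r | Mr ⊆ N}. Semiprimeness makes the
idempotent e generating the annihilator of I central, so M = Me ⊕ M(1 - e), and `N` is essential in
M(1 - e). Indeed, dual basis coordinates of elements of `N` lie in I, so Ne = 0; and a submodule K
with N ∩ K = 0 satisfies KI = 0, which forces ke = k on K. Nonsingularity also passes through
coordinates, since functionals send Z(M) into Z(R). -/

theorem mem_rightAnnihilator_ring {X : Set R} {r : R} :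
    r ∈ rightAnnihilator R X ↔ ∀ n ∈ X, n * r = 0 := Iff.rfl

theorem mem_span_op_idempotent {e r : R} (he : IsIdempotentElem e) :
    r ∈ Submodule.span Rᵐᵒᵖ {e} ↔ e * r = r := by
  rw [Submodule.mem_span_singleton]
  constructor
  · rintro ⟨a, rfl⟩
    rw [← op_unop a, op_smul_eq_mul, ← mul_assoc, he.eq]
  · exact fun h => ⟨op r, by rw [op_smul_eq_mul, h]⟩

/-- In a semiprime ring the left and right annihilators of a two-sided ideal agree. -/
theorem IsSemiprimeRing.forall_mul_eq_zero_comm (hR : IsSemiprimeRing R) (I : TwoSidedIdeal R)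
    {x : R} : (∀ a ∈ I, x * a = 0) ↔ ∀ a ∈ I, a * x = 0 := by
  constructor
  · intro h a ha
    refine hR _ fun r => ?_
    rw [show a * x * r * (a * x) = a * (x * (r * a)) * x by simp only [mul_assoc],
      h _ (I.mul_mem_left r a ha), mul_zero, zero_mul]
  · intro h a ha
    refine hR _ fun r => ?_
    rw [show x * a * r * (x * a) = x * (a * r * x) * a by simp only [mul_assoc],
      h _ (I.mul_mem_right a r ha), mul_zero, zero_mul]

/-- In a semiprime ring a left semicentral idempotent is central. -/
theorem IsSemiprimeRing.commute_of_semicentral (hR : IsSemiprimeRing R) {e : R}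
    (he : ∀ r, e * (r * e) = r * e) (r : R) : e * r = r * e := by
  have h : e * r - e * (r * e) = 0 := by
    refine hR _ fun s => ?_
    -- The element is er(1 - e), and (1 - e)se = 0 by semicentrality.
    have hs : s * (e * r) - e * (s * (e * r)) = 0 := by
      rw [sub_eq_zero, ← mul_assoc s e r, ← mul_assoc e, he]
    calc (e * r - e * (r * e)) * s * (e * r - e * (r * e))
        = e * r * (s * (e * r) - e * (s * (e * r))) * (1 - e) := by noncomm_ring
      _ = 0 := by rw [hs, mul_zero, zero_mul]
  rw [sub_eq_zero.1 h, he]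

/-- In a semiprime quasi-Baer ring the left annihilator of a two-sided ideal is generated by a
central idempotent that annihilates the ideal. -/
theorem exists_central_idempotent (hR : IsSemiprimeRing R) (hQ : IsQuasiBaerRing R)
    (I : TwoSidedIdeal R) :
    ∃ e : R, IsIdempotentElem e ∧ (∀ r, e * r = r * e) ∧ (∀ a ∈ I, a * e = 0) ∧
      ∀ x : R, (∀ a ∈ I, x * a = 0) → e * x = x := by
  obtain ⟨e, he, hI⟩ := hQ I
  have key (x : R) : (∀ a ∈ I, a * x = 0) ↔ e * x = x := by
    rw [← mem_span_op_idempotent he, ← hI]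
    exact Iff.rfl
  have hIe : ∀ a ∈ I, a * e = 0 := (key e).2 he.eq
  -- Since `I` absorbs right factors, `r * e` again annihilates it; hence e is left semicentral.
  refine ⟨e, he, hR.commute_of_semicentral fun r => (key _).1 fun a ha => ?_, hIe,
    fun x hx => (key x).1 ((hR.forall_mul_eq_zero_comm I).1 hx)⟩
  rw [← mul_assoc, hIe _ (I.mul_mem_right a r ha)]

theorem IsPrimeRing.isSemiprimeRing (hR : IsPrimeRing R) : IsSemiprimeRing R :=
  fun a ha => (hR.2 a a ha).elim id id

theorem IsPrimeRing.isQuasiBaerRing (hR : IsPrimeRing R) : IsQuasiBaerRing R := by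
  intro I
  by_cases hI : ∀ a ∈ I, a = 0
  · refine ⟨1, IsIdempotentElem.one, Submodule.ext fun r => ?_⟩
    rw [mem_span_op_idempotent IsIdempotentElem.one, mem_rightAnnihilator_ring]
    exact iff_of_true (fun a ha => by rw [hI a ha, zero_mul]) (one_mul r)
  · push Not at hI
    obtain ⟨a, ha, ha0⟩ := hI
    refine ⟨0, IsIdempotentElem.zero, Submodule.ext fun r => ?_⟩
    rw [mem_span_op_idempotent IsIdempotentElem.zero, mem_rightAnnihilator_ring, zero_mul]
    refine ⟨fun h => ?_, fun h a _ => by rw [← h, mul_zero]⟩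
    exact ((hR.2 a r fun s => h _ (I.mul_mem_right a s ha)).resolve_left ha0).symm

theorem IsBaerRing.isQuasiBaerRing (hR : IsBaerRing R) : IsQuasiBaerRing R := fun I => hR I

/-- An essential annihilator eR meets (1 - e)R in zero, so e = 1 and x = xe = 0. -/
theorem IsBaerRing.isRightNonsingularRing (hR : IsBaerRing R) : IsRightNonsingularRing R := by
  refine (Submodule.eq_bot_iff _).2 fun x hx => ?_
  obtain ⟨e, he, hX⟩ := hR {x}
  have hess : IsEssentialIn (rightAnnihilator R {x}) ⊤ := hx
  have hbot : rightAnnihilator R {x} ⊓ Submodule.span Rᵐᵒᵖ {1 - e} = ⊥ := by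
    refine (Submodule.eq_bot_iff _).2 ?_
    rintro r ⟨hr, hr'⟩
    rw [hX] at hr
    have h1 := (mem_span_op_idempotent he).1 hr
    have h2 := (mem_span_op_idempotent he.one_sub).1 hr'
    rw [sub_mul, one_mul, h1, sub_self] at h2
    exact h2.symm
  have hspan : Submodule.span Rᵐᵒᵖ {1 - e} = ⊥ := by
    by_contra h
    exact hess.2 _ le_top h hbot
  rw [Submodule.span_singleton_eq_bot, sub_eq_zero] at hspan
  have he' : e ∈ rightAnnihilator R {x} := hX ▸ Submodule.mem_span_singleton_self e
  have hxe : x * e = 0 := he' x rfl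
  rwa [← hspan, mul_one] at hxe

end Ring

theorem IsBaerRing.isSemiprimeRing_of_comm {R : Type*} [CommRing R] (hR : IsBaerRing R) :
    IsSemiprimeRing R := by
  intro a ha
  obtain ⟨e, he, hX⟩ := hR {a}
  have h1 : a ∈ rightAnnihilator R {a} := by
    rintro n rfl
    simpa using ha 1
  have h2 : e ∈ rightAnnihilator R {a} := hX ▸ Submodule.mem_span_singleton_self e
  rw [hX, mem_span_op_idempotent he, mul_comm] at h1
  exact h1.symm.trans (h2 a rfl)

/-- The C⋆-identity, used twice, reduces a = 0 to a⋆(aa⋆a) = 0. -/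
theorem isSemiprimeRing_of_cstarAlgebra (A : Type*) [CStarAlgebra A] : IsSemiprimeRing A := by
  intro a ha
  rw [← CStarRing.star_mul_self_eq_zero_iff, ← CStarRing.star_mul_self_eq_zero_iff, star_mul,
    star_star, mul_assoc, ← mul_assoc a, ha, mul_zero]

section Projective

variable {R M : Type*} [Ring R] [AddCommGroup M] [Module Rᵐᵒᵖ M]

/-- The two-sided ideal of the elements of `R` that multiply `M` into the submodule `N`. -/
def colonIdeal (N : Submodule Rᵐᵒᵖ M) : TwoSidedIdeal R :=
  .mk' {r | ∀ p : M, op r • p ∈ N}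
    (fun p => by simp)
    (fun {x y} hx hy p => by rw [op_add, add_smul]; exact N.add_mem (hx p) (hy p))
    (fun {x} hx p => by rw [op_neg, neg_smul]; exact N.neg_mem (hx p))
    (fun {x y} hy p => by rw [op_mul, mul_smul]; exact hy _)
    (fun {x y} hx p => by rw [op_mul, mul_smul]; exact N.smul_mem _ (hx p))

theorem mem_colonIdeal {N : Submodule Rᵐᵒᵖ M} {r : R} :
    r ∈ colonIdeal N ↔ ∀ p : M, op r • p ∈ N := TwoSidedIdeal.mem_mk' ..

/-- Full invariance is applied to the rank-one endomorphisms x ↦ p f(x). -/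
theorem unop_apply_mem_colonIdeal {N : Submodule Rᵐᵒᵖ M} (hN : N.IsFullyInvariant)
    (f : M →ₗ[Rᵐᵒᵖ] Rᵐᵒᵖ) {n : M} (hn : n ∈ N) : unop (f n) ∈ colonIdeal N :=
  mem_colonIdeal.2 fun p => hN (f.smulRight p) hn

/-- A linear functional maps the singular submodule of `M` into that of `R`. -/
theorem unop_apply_mem_singularSubmodule (f : M →ₗ[Rᵐᵒᵖ] Rᵐᵒᵖ) {m : M}
    (hm : m ∈ singularSubmodule R M) : unop (f m) ∈ singularSubmodule R R := by
  have hess : IsEssentialIn (rightAnnihilator R {m}) ⊤ := hm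
  refine ⟨le_top, fun K _ hK => ne_bot_of_le_ne_bot (hess.2 K le_top hK)
    (inf_le_inf_right K ?_)⟩
  rintro r hr n rfl
  have h : op r * f m = 0 := by
    rw [← smul_eq_mul, ← map_smul, hr m rfl, map_zero]
  exact op_injective h

/-- The dual basis lemma, in the form of the map to its coordinates. -/
theorem exists_dual_basis {S : Type*} [Ring S] [Module S M] (hM : Module.Projective S M) :
    ∃ s : M →ₗ[S] M →₀ S, ∀ p : M, (s p).sum (fun q a => a • q) = p := by
  obtain ⟨s, hs⟩ := hM.out
  exact ⟨s, hs⟩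

theorem isNonsingular_of_projective (hR : IsRightNonsingularRing R)
    (hM : Module.Projective Rᵐᵒᵖ M) : IsNonsingular R M := by
  refine (Submodule.eq_bot_iff _).2 fun m hm => ?_
  obtain ⟨s, hs⟩ := exists_dual_basis hM
  have h (q : M) : s m q = 0 := by
    have h1 := unop_apply_mem_singularSubmodule (Finsupp.lapply q ∘ₗ s) hm
    rw [show singularSubmodule R R = ⊥ from hR, Submodule.mem_bot, unop_eq_zero_iff] at h1
    exact h1
  rw [← hs m, Finsupp.sum, Finset.sum_eq_zero fun q _ => by rw [h q, zero_smul]]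

theorem isDirectSummand_of_isIdempotentElem {S : Type*} [Ring S] [Module S M]
    {f : M →ₗ[S] M} (hf : IsIdempotentElem f) : IsDirectSummand (LinearMap.ker f) :=
  ⟨LinearMap.range f, (LinearMap.IsIdempotentElem.isCompl hf).symm⟩

theorem isFIExtending_of_projective (hR : IsSemiprimeRing R) (hQ : IsQuasiBaerRing R)
    (hM : Module.Projective Rᵐᵒᵖ M) : IsFIExtending Rᵐᵒᵖ M := by
  intro N hN
  obtain ⟨e, he, hcomm, hIe, hann⟩ := exists_central_idempotent hR hQ (colonIdeal N)
  obtain ⟨s, hs⟩ := exists_dual_basis hM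
  let f : M →ₗ[Rᵐᵒᵖ] M :=
    { toFun := fun p => op e • p
      map_add' := smul_add _
      map_smul' := fun a p => by
        -- Multiplication by e is linear because e is central.
        rw [RingHom.id_apply, ← mul_smul, ← mul_smul, ← op_unop a, ← op_mul, ← op_mul, hcomm] }
  have hf : IsIdempotentElem f := LinearMap.ext fun p => by
    change op e • op e • p = op e • p
    rw [← mul_smul, ← op_mul, he.eq]
  refine ⟨LinearMap.ker f, isDirectSummand_of_isIdempotentElem hf, fun n hn => ?_,
    fun K hK hK0 hNK => hK0 ((Submodule.eq_bot_iff _).2 fun k hk => ?_)⟩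
  · change op e • n = 0
    rw [← hs n, Finsupp.sum, Finset.smul_sum]
    refine Finset.sum_eq_zero fun q _ => ?_
    have h := hIe _ (unop_apply_mem_colonIdeal hN (Finsupp.lapply q ∘ₗ s) hn)
    rw [← mul_smul, ← op_unop (s n q), ← op_mul]
    rw [show unop (s n q) * e = 0 from h, op_zero, zero_smul]
  -- Here kI ⊆ N ∩ K = 0, so the coordinates of `k` annihilate I from the left and are fixed by e;
  -- thus k = ke = 0.
  · have hkI : ∀ a ∈ colonIdeal N, op a • k = 0 := fun a ha => by
      have h : op a • k ∈ N ⊓ K := ⟨mem_colonIdeal.1 ha k, K.smul_mem _ hk⟩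
      rwa [hNK] at h
    have hek : op e • k = k := by
      have hq (q : M) : op e * s k q = s k q := by
        have h := hann (unop (s k q)) fun a ha => by
          have h0 : op a * s k q = 0 := by
            rw [← smul_eq_mul, ← Finsupp.smul_apply, ← map_smul, hkI a ha, map_zero,
              Finsupp.zero_apply]
          exact op_injective h0
        rw [hcomm] at h
        exact unop_injective h
      conv_rhs => rw [← hs k]
      conv_lhs => rw [← hs k]
      rw [Finsupp.sum, Finset.smul_sum]
      exact Finset.sum_congr rfl fun q _ => by rw [← mul_smul, hq]
    exact hek.symm.trans (hK hk)

end Projective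

end RightModule

theorem mainTheorem9 :
    (∀ (R : Type*) [Ring R],
      RightModule.IsRightNonsingularRing R → RightModule.IsSemiprimeRing R →
      RightModule.IsQuasiBaerRing R →
      ∀ (M : Type*) [AddCommGroup M] [Module Rᵐᵒᵖ M], Module.Projective Rᵐᵒᵖ M →
        RightModule.IsNonsingular R M ∧ RightModule.IsFIExtending Rᵐᵒᵖ M) ∧
    (∀ (R : Type*) [Ring R],
      RightModule.IsPrimeRing R → RightModule.IsRightNonsingularRing R →
      RightModule.IsSemiprimeRing R ∧ RightModule.IsQuasiBaerRing R) ∧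
    (∀ (R : Type*) [CommRing R],
      RightModule.IsBaerRing R →
      RightModule.IsRightNonsingularRing R ∧ RightModule.IsSemiprimeRing R ∧
        RightModule.IsQuasiBaerRing R) ∧
    (∀ (A : Type*) [CStarAlgebra A],
      RightModule.IsAWStarAlgebra A →
      RightModule.IsRightNonsingularRing A ∧ RightModule.IsSemiprimeRing A ∧
        RightModule.IsQuasiBaerRing A) := by
  refine ⟨fun R _ hN hS hQ M _ _ hM => ⟨?_, ?_⟩, fun R _ hP _ => ⟨?_, ?_⟩,
    fun R _ hB => ⟨?_, ?_, ?_⟩, fun A _ hB => ⟨?_, ?_, ?_⟩⟩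
  · exact RightModule.isNonsingular_of_projective hN hM
  · exact RightModule.isFIExtending_of_projective hS hQ hM
  · exact hP.isSemiprimeRing
  · exact hP.isQuasiBaerRing
  · exact hB.isRightNonsingularRing
  · exact hB.isSemiprimeRing_of_comm
  · exact hB.isQuasiBaerRing
  · exact RightModule.IsBaerRing.isRightNonsingularRing hB
  · exact RightModule.isSemiprimeRing_of_cstarAlgebra A
  · exact RightModule.IsBaerRing.isQuasiBaerRing hB
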